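/- Let $(\Omega,\mathscr F,\nu)$ be a complete probability space, $(T,\Sigma,\mu)$ a finite measure space, and $\mathbb R^\ell_+$ the nonnegative orthant of $\mathbb R^\ell$ with the coordinatewise order. Let $a:T\times\Omega\to\mathbb R^\ell_+$ and $U:T\times\Omega\times\mathbb R^\ell_+\to\mathbb R$ satisfy: (A1) $a$ is $\Sigma\otimes\mathscr F$-measurable, and for every $\omega\in\Omega$ the function $a(\cdot,\omega)$ is $\mu$-integrable and every coordinate of $\int_T a(\cdot,\omega)\,d\mu$ is positive; (A2) $U(\cdot,\cdot,x)$ is $\Sigma\otimes\mathscr F$-measurable for every $x\in\mathbb R^\ell_+$, and $U(t,\omega,\cdot)$ is continuous on $\mathbb R^\ell_+$ for every $(t,\omega)\in T\times\Omega$; (A3) $U(t,\omega,x+y)>U(t,\omega,x)$ for all $(t,\omega)\in T\times\Omega$ and all $x,y\in\mathbb R^\ell_+$ with $y\neq 0$. Let $\Delta=\{p\in\mathbb R^\ell: p^h>0 \text{ for all } h,\ \sum_{h=1}^\ell p^h=1\}$. For $(t,\omega,p)\in T\times\Omega\times\Delta$ put $$B(t,\omega,p)=\{x\in\mathbb R^\ell_+:\langle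 p,x\rangle\le\langle p,a(t,\omega)\rangle\},$$ $$\gamma(t,\omega,p)=\frac{1}{\min_h p^h}\sum_{h=1}^\ell a^h(t,\omega),\qquad X(t,\omega,p)=\{x\in\mathbb R^\ell_+: x^h\le\gamma(t,\omega,p)\text{ for all }h\},$$ $$C(t,\omega,p)=\{y\in\mathbb R^\ell_+: U(t,\omega,y)\ge U(t,\omega,x)\text{ for all }x\in B(t,\omega,p)\},$$ $$C^X(t,\omega,p)=C(t,\omega,p)\cap X(t,\omega,p).$$ Let $$\int_T C^X(\cdot,\omega,p)\,d\mu=\Bigl\{\int_T f\,d\mu : f:T\to\mathbb R^\ell\ \mu\text{-integrable},\ f(t)\in C^X(t,\omega,p)\text{ for }\mu\text{-almost all }t\in T\Bigr\}$$ be the Aumann integral. Then for every $p\in\Delta$ the correspondence $\omega\mapsto\int_T C^X(\cdot,\omega,p)\,d\mu$ is lower measurable, that is, for every open $V\subseteq\mathbb R^\ell$, $$\Bigl\{\omega\in\Omega:\ V\cap\int_T C^X(\cdot,\omega,p)\,d\mu\neq\emptyset\Bigr\}\in\mathscr F.$$ -/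

import Mathlib

open MeasureTheory

namespace DiffInfoEconomy

/-- The consumption set `ℝ^ℓ_+`. The commodity space `ℝ^ℓ` is `Fin ℓ → ℝ` with its coordinatewise
order; only its topology, its Borel structure and integration are used, which do not depend on the
choice of a norm. -/
def orthant (ℓ : ℕ) : Set (Fin ℓ → ℝ) := {x | 0 ≤ x}

/-- The price simplex `Δ`: strictly positive prices whose coordinates sum to one. -/
def priceSimplex (ℓ : ℕ) : Set (Fin ℓ → ℝ) := {p | (∀ h, 0 < p h) ∧ ∑ h, p h = 1}

section Agents

variable {T Ω : Type*} {ℓ : ℕ}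

/-- The budget set `B(t, ω, p)`. -/
def budget (a : T → Ω → Fin ℓ → ℝ) (t : T) (ω : Ω) (p : Fin ℓ → ℝ) : Set (Fin ℓ → ℝ) :=
  {x | x ∈ orthant ℓ ∧ ∑ h, p h * x h ≤ ∑ h, p h * a t ω h}

/-- `δ(p)`, the smallest coordinate of `p` (a minimum, since `ℓ ≥ 1` whenever `p ∈ Δ`). -/
noncomputable def minPrice (p : Fin ℓ → ℝ) : ℝ := ⨅ h, p h

/-- `γ(t, ω, p) = (1 / δ(p)) ∑ h, a^h(t, ω)`. -/
noncomputable def boundLevel (a : T → Ω → Fin ℓ → ℝ) (t : T) (ω : Ω) (p : Fin ℓ → ℝ) : ℝ :=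
  1 / minPrice p * ∑ h, a t ω h

/-- `b(t, ω, p) = (γ(t, ω, p), …, γ(t, ω, p))`. -/
noncomputable def boundVector (a : T → Ω → Fin ℓ → ℝ) (t : T) (ω : Ω) (p : Fin ℓ → ℝ) :
    Fin ℓ → ℝ :=
  fun _ => boundLevel a t ω p

/-- `X(t, ω, p) = {x ∈ ℝ^ℓ_+ : x ≤ b(t, ω, p)}`. -/
def boundedSet (a : T → Ω → Fin ℓ → ℝ) (t : T) (ω : Ω) (p : Fin ℓ → ℝ) : Set (Fin ℓ → ℝ) :=
  {x | x ∈ orthant ℓ ∧ x ≤ boundVector a t ω p}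

/-- `C(t, ω, p)`: bundles at least as good as every bundle of the budget set. -/
def preferred (a : T → Ω → Fin ℓ → ℝ) (U : T → Ω → (Fin ℓ → ℝ) → ℝ) (t : T) (ω : Ω)
    (p : Fin ℓ → ℝ) : Set (Fin ℓ → ℝ) :=
  {y | y ∈ orthant ℓ ∧ ∀ x ∈ budget a t ω p, U t ω x ≤ U t ω y}

/-- The preferred set `C^X(t, ω, p) = C(t, ω, p) ∩ X(t, ω, p)`. -/
def preferredX (a : T → Ω → Fin ℓ → ℝ) (U : T → Ω → (Fin ℓ → ℝ) → ℝ) (t : T) (ω : Ω)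
    (p : Fin ℓ → ℝ) : Set (Fin ℓ → ℝ) :=
  preferred a U t ω p ∩ boundedSet a t ω p

/-- The random initial endowment takes values in `ℝ^ℓ_+`, is jointly measurable, and in every state
it is integrable with an aggregate all of whose coordinates are positive. -/
structure EndowmentAssumption [MeasurableSpace T] [MeasurableSpace Ω] (μ : Measure T)
    (a : T → Ω → Fin ℓ → ℝ) : Prop where
  mem_orthant : ∀ t ω, a t ω ∈ orthant ℓ
  measurable : Measurable (fun z : T × Ω => a z.1 z.2)
  integrable : ∀ ω, Integrable (fun t => a t ω) μ
  integral_pos : ∀ ω h, 0 < (∫ t, a t ω ∂μ) h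

/-- `U(·, ·, x)` is jointly measurable for each `x ∈ ℝ^ℓ_+`, and `U(t, ω, ·)` is continuous on
`ℝ^ℓ_+`. Values of `U` at bundles outside `ℝ^ℓ_+` are never used. -/
structure UtilityRegular [MeasurableSpace T] [MeasurableSpace Ω]
    (U : T → Ω → (Fin ℓ → ℝ) → ℝ) : Prop where
  measurable : ∀ x ∈ orthant ℓ, Measurable (fun z : T × Ω => U z.1 z.2 x)
  continuousOn : ∀ t ω, ContinuousOn (U t ω) (orthant ℓ)

/-- `U(t, ω, x + y) > U(t, ω, x)` for `x ∈ ℝ^ℓ_+` and `y > 0`, where `y > 0` means `y ≥ 0` and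
`y ≠ 0`. -/
def UtilityMonotone (U : T → Ω → (Fin ℓ → ℝ) → ℝ) : Prop :=
  ∀ t ω, ∀ x ∈ orthant ℓ, ∀ y ∈ orthant ℓ, y ≠ 0 → U t ω x < U t ω (x + y)

end Agents

/-- The set `𝒮_F` of integrable selections of `F`: integrable `f` with `f t ∈ F t` for almost all
`t`. -/
def integrableSelections {T : Type*} {ℓ : ℕ} [MeasurableSpace T] (μ : Measure T)
    (F : T → Set (Fin ℓ → ℝ)) : Set (T → Fin ℓ → ℝ) :=
  {f | Integrable f μ ∧ ∀ᵐ t ∂μ, f t ∈ F t}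

/-- The Aumann integral of a correspondence: the set of integrals of its integrable selections. -/
noncomputable def aumannIntegral {T : Type*} {ℓ : ℕ} [MeasurableSpace T] (μ : Measure T)
    (F : T → Set (Fin ℓ → ℝ)) : Set (Fin ℓ → ℝ) :=
  (fun f => ∫ t, f t ∂μ) '' integrableSelections μ F

/-- Lower measurability: `{ω | F ω ∩ V ≠ ∅}` is measurable for every open `V`. -/
def LowerMeasurable {Ω : Type*} {ℓ : ℕ} [MeasurableSpace Ω] (F : Ω → Set (Fin ℓ → ℝ)) : Prop :=
  ∀ V : Set (Fin ℓ → ℝ), IsOpen V → MeasurableSet {ω | (F ω ∩ V).Nonempty}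

end DiffInfoEconomy

/-! Strict monotonicity gives `preferredX` a jointly measurable Castaing representation. Scale a
dense sequence of the unit cube by `boundLevel`, and replace a point by `boundVector` wherever it is
not preferred. Moving a preferred bundle slightly towards `boundVector` makes it strictly better,
and strict preference is an open condition, so the retained points are dense
(`preferredX_subset_closure`). All of them are bounded by the integrable `boundLevel`.

For such a representation `f`, the integrals of `f (n t) (t, ω)` with `n` measurable and
finite-valued are dense in the Aumann integral. Each is measurable in `ω` by Fubini, but there may
be uncountably many `n`, since `L¹(μ)` need not be separable. Joint measurability helps: all
sections of `f i` live on one countably generated sub-σ-algebra, hence in a separable part of `L¹`,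
and countably many `n` serve every `ω` at once (`exists_countable_selectors`). The event is then a
countable union of measurable sets. -/

namespace DiffInfoEconomy

open MeasurableSpace Filter Topology

/-! ### Separability of the sections of jointly measurable functions -/

section Sections

variable {T Ω : Type*} [mT : MeasurableSpace T] [MeasurableSpace Ω]

/-- The sections of a measurable set in a product all lie in one countably generated
sub-`σ`-algebra. -/
theorem exists_countable_generateFrom_sections {S : Set (T × Ω)} (hS : MeasurableSet S) :
    ∃ c : Set (Set T), c.Countable ∧ (∀ s ∈ c, MeasurableSet s) ∧
      ∀ ω, MeasurableSet[generateFrom c] {t | (t, ω) ∈ S} := by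
  rw [← generateFrom_prod] at hS
  induction S, hS using generateFrom_induction with
  | hC S hS _ =>
    obtain ⟨A, hA, B, hB, rfl⟩ := hS
    refine ⟨{A}, Set.countable_singleton _, by simpa using hA, fun ω => ?_⟩
    by_cases hω : ω ∈ B
    · simpa [hω] using measurableSet_generateFrom (Set.mem_singleton A)
    · simp [hω]
  | empty => exact ⟨∅, Set.countable_empty, by simp, by simp⟩
  | compl S _ ih =>
    obtain ⟨c, hc, hcm, h⟩ := ih
    exact ⟨c, hc, hcm, fun ω => (h ω).compl⟩
  | iUnion S _ ih =>
    choose c hc hcm h using ih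
    refine ⟨⋃ i, c i, Set.countable_iUnion hc, ?_, fun ω => ?_⟩
    · simp only [Set.mem_iUnion]
      rintro s ⟨i, hi⟩
      exact hcm i s hi
    · have : {t | (t, ω) ∈ ⋃ i, S i} = ⋃ i, {t | (t, ω) ∈ S i} := by ext; simp
      rw [this]
      exact MeasurableSet.iUnion fun i =>
        generateFrom_mono (Set.subset_iUnion c i) _ (h i ω)

/-- Pool the countable families obtained from the preimages of a countable generating family of `E`.
-/
theorem exists_countablyGenerated_measurable_sections {E : Type*} [mE : MeasurableSpace E]
    [CountablyGenerated E] {g : T × Ω → E} (hg : Measurable g) :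
    ∃ m : MeasurableSpace T, m ≤ mT ∧ @CountablyGenerated T m ∧
      ∀ ω, Measurable[m] fun t => g (t, ω) := by
  have key : ∀ s : countableGeneratingSet E, ∃ c : Set (Set T), c.Countable ∧
      (∀ s ∈ c, MeasurableSet s) ∧
      ∀ ω, MeasurableSet[generateFrom c] {t | (t, ω) ∈ g ⁻¹' s.1} := fun s =>
    exists_countable_generateFrom_sections (hg (measurableSet_countableGeneratingSet s.2))
  choose c hc hcm h using key
  have : Countable (countableGeneratingSet E) :=
    (countable_countableGeneratingSet (α := E)).to_subtype
  refine ⟨generateFrom (⋃ s, c s), generateFrom_le ?_,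
    @CountablyGenerated.mk _ (_) ⟨_, Set.countable_iUnion hc, rfl⟩, fun ω => ?_⟩
  · simp only [Set.mem_iUnion]
    rintro s ⟨i, hi⟩
    exact hcm i s hi
  · have hE : mE = generateFrom (countableGeneratingSet E) :=
      generateFrom_countableGeneratingSet.symm
    suffices h' : Measurable[generateFrom (⋃ s, c s), generateFrom (countableGeneratingSet E)]
        fun t => g (t, ω) from
      fun s hs => h' (hE ▸ hs)
    refine @measurable_generateFrom _ _ (_) _ _ fun s hs => ?_
    exact generateFrom_mono (Set.subset_iUnion c ⟨s, hs⟩) _ (h ⟨s, hs⟩ ω)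

variable {E : Type*} [NormedAddCommGroup E] [SecondCountableTopology E]
  [MeasurableSpace E] [BorelSpace E]

/-- The sections of a jointly measurable function form a separable subset of `L¹`. -/
theorem exists_seq_integral_norm_sub_lt (μ : Measure T) [IsFiniteMeasure μ] {g : T × Ω → E}
    (hg : Measurable g) (hint : ∀ ω, Integrable (fun t => g (t, ω)) μ) :
    ∃ d : ℕ → T → E, (∀ k, StronglyMeasurable (d k)) ∧ (∀ k, Integrable (d k) μ) ∧
      ∀ ω, ∀ ε > 0, ∃ k, ∫ t, ‖g (t, ω) - d k t‖ ∂μ < ε := by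
  obtain ⟨m, hm, hcg, hmeas⟩ := exists_countablyGenerated_measurable_sections hg
  have : Fact ((1 : ENNReal) ≠ ⊤) := ⟨by simp⟩
  -- `L¹` of the trimmed measure is separable because `m` is countably generated.
  let u : ℕ → Lp E 1 (μ.trim hm) := TopologicalSpace.denseSeq _
  have hu : ∀ k, StronglyMeasurable[m] (u k) := fun k => Lp.stronglyMeasurable (u k)
  refine ⟨fun k => u k, fun k => (hu k).mono hm,
    fun k => integrable_of_integrable_trim hm (L1.integrable_coeFn (u k)), fun ω ε hε => ?_⟩
  have hsm : StronglyMeasurable[m] fun t => g (t, ω) := (hmeas ω).stronglyMeasurable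
  have hi : Integrable (fun t => g (t, ω)) (μ.trim hm) := (hint ω).trim hm hsm
  obtain ⟨k, hk⟩ := (TopologicalSpace.denseRange_denseSeq (Lp E 1 (μ.trim hm))).exists_dist_lt
    (hi.toL1 _) hε
  refine ⟨k, ?_⟩
  rw [dist_eq_norm, L1.norm_eq_integral_norm] at hk
  change ∫ t, ‖g (t, ω) - u k t‖ ∂μ < ε
  rw [integral_trim hm (f := fun t => ‖g (t, ω) - u k t‖) (hsm.sub (hu k)).norm]
  refine lt_of_eq_of_lt (integral_congr_ae ?_) hk
  filter_upwards [Lp.coeFn_sub (hi.toL1 _) (u k), hi.coeFn_toL1] with t h1 h2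
  rw [h1, Pi.sub_apply, h2]

/-- A countable family of measurable selectors suffices to approximate, simultaneously for all
`ω`, the integrals obtained by selecting a coordinate of `g (·, ω)` measurably. -/
theorem exists_countable_selectors [NormedSpace ℝ E] (μ : Measure T) [IsFiniteMeasure μ] {ι : Type*} [Fintype ι]
    [MeasurableSpace ι] [MeasurableSingletonClass ι] {g : T × Ω → ι → E}
    (hg : Measurable g) (hint : ∀ ω, Integrable (fun t => g (t, ω)) μ) :
    ∃ P : Set (T → ι), P.Countable ∧ (∀ n ∈ P, Measurable n) ∧
      ∀ ω, ∀ n : T → ι, Measurable n → ∀ ε > 0, ∃ n' ∈ P,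
        ‖∫ t, g (t, ω) (n t) ∂μ - ∫ t, g (t, ω) (n' t) ∂μ‖ < ε := by
  obtain ⟨d, hd, hdi, happ⟩ := exists_seq_integral_norm_sub_lt μ hg hint
  have hev : ∀ {h : T → ι → E}, Measurable h → ∀ {n : T → ι}, Measurable n →
      Measurable fun t => h t (n t) := by
    intro h hh n hn
    have : Measurable fun z : T × ι => h z.1 z.2 :=
      measurable_from_prod_countable_left fun i => measurable_pi_iff.1 hh i
    exact this.comp (measurable_id.prodMk hn)
  have hevi : ∀ {h : T → ι → E}, Measurable h → Integrable h μ → ∀ {n : T → ι}, Measurable n →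
      Integrable (fun t => h t (n t)) μ := fun hh hi n hn =>
    hi.mono (hev hh hn).aestronglyMeasurable (ae_of_all _ fun t => norm_le_pi_norm _ _)
  let P₀ := {n : T → ι // Measurable n}
  let Φ : P₀ → ℕ → E := fun n k => ∫ t, d k t (n.1 t) ∂μ
  -- The coarsest topology making every `∫ d k t (n t)` continuous in `n`. Being induced from a
  -- countable product of second countable spaces, it has a countable dense subset.
  let τ : TopologicalSpace P₀ := TopologicalSpace.induced Φ inferInstance
  have : SecondCountableTopology P₀ := TopologicalSpace.secondCountableTopology_induced _ _ Φ
  obtain ⟨P, hPc, hPd⟩ := TopologicalSpace.exists_countable_dense P₀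
  refine ⟨Subtype.val '' P, hPc.image _, ?_, fun ω n hn ε hε => ?_⟩
  · rintro _ ⟨n, -, rfl⟩
    exact n.2
  obtain ⟨k, hk⟩ := happ ω (ε / 3) (by positivity)
  have hgω : Measurable fun t => g (t, ω) := hg.comp measurable_prodMk_right
  have hclose : ∀ n : T → ι, Measurable n →
      ‖∫ t, g (t, ω) (n t) ∂μ - ∫ t, d k t (n t) ∂μ‖ < ε / 3 := by
    intro n hn
    rw [← integral_sub (hevi hgω (hint ω) hn) (hevi (hd k).measurable (hdi k) hn)]
    refine (norm_integral_le_integral_norm _).trans_lt (lt_of_le_of_lt ?_ hk)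
    refine integral_mono_of_nonneg (ae_of_all _ fun t => norm_nonneg _)
      ((hint ω).sub (hdi k)).norm (ae_of_all _ fun t => ?_)
    exact norm_le_pi_norm (g (t, ω) - d k t) (n t)
  have hcont : Continuous fun m : P₀ => Φ m k := 
    (continuous_apply (A := fun _ : ℕ => E) k).comp (continuous_induced_dom (f := Φ))
  have hopen : IsOpen {m : P₀ | ‖Φ ⟨n, hn⟩ k - Φ m k‖ < ε / 3} :=
    isOpen_lt (continuous_const.sub hcont).norm continuous_const
  obtain ⟨n', hn', hn'P⟩ := hPd.inter_open_nonempty _ hopen ⟨⟨n, hn⟩, by simpa using hε⟩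
  refine ⟨n', ⟨n', hn'P, rfl⟩, ?_⟩
  have h1 := hclose n hn
  have h2 := hclose n' n'.2
  have h3 : ‖(∫ t, d k t (n t) ∂μ) - ∫ t, d k t (n'.1 t) ∂μ‖ < ε / 3 := hn'
  calc _ = ‖(∫ t, g (t, ω) (n t) ∂μ - ∫ t, d k t (n t) ∂μ)
        + ((∫ t, d k t (n t) ∂μ) - ∫ t, d k t (n'.1 t) ∂μ)
        - (∫ t, g (t, ω) (n'.1 t) ∂μ - ∫ t, d k t (n'.1 t) ∂μ)‖ := by congr 1; abel
    _ ≤ _ := (norm_sub_le _ _).trans (add_le_add_left (norm_add_le _ _) _)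
    _ < ε := by linarith

end Sections

/-! ### Aumann integrals of correspondences with a Castaing representation -/

/-- A correspondence with a jointly measurable, integrably bounded Castaing representation has a
lower measurable Aumann integral. -/
theorem lowerMeasurable_aumannIntegral_of_castaing {T Ω : Type*} [MeasurableSpace T]
    [MeasurableSpace Ω] {ℓ : ℕ} (μ : Measure T) [IsFiniteMeasure μ]
    {F : Ω → T → Set (Fin ℓ → ℝ)} {f : ℕ → T × Ω → Fin ℓ → ℝ} (hf : ∀ n, Measurable (f n))
    (hmem : ∀ n t ω, f n (t, ω) ∈ F ω t)
    (hdense : ∀ t ω, F ω t ⊆ closure (Set.range fun n => f n (t, ω)))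
    {b : T → Ω → ℝ} (hb : ∀ ω, Integrable (fun t => b t ω) μ)
    (hle : ∀ n t ω, ‖f n (t, ω)‖ ≤ b t ω) :
    LowerMeasurable fun ω => aumannIntegral μ (F ω) := by
  intro V hV
  have hfun : Measurable fun z : (T × Ω) × ℕ => f z.2 z.1 :=
    measurable_from_prod_countable_left hf
  have hsel : ∀ {n : T → ℕ}, Measurable n → Measurable fun z : T × Ω => f (n z.1) z := by
    intro n hn
    exact hfun.comp (measurable_id.prodMk (hn.comp measurable_fst))
  have hseli : ∀ {n : T → ℕ}, Measurable n → ∀ ω, Integrable (fun t => f (n t) (t, ω)) μ := by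
    intro n hn ω
    exact (hb ω).mono' ((hsel hn).comp measurable_prodMk_right).aestronglyMeasurable
      (ae_of_all _ fun t => hle _ _ _)
  have hfin : ∀ N : ℕ, ∃ P : Set (T → Fin (N + 1)), P.Countable ∧ (∀ n ∈ P, Measurable n) ∧
      ∀ ω, ∀ n : T → Fin (N + 1), Measurable n → ∀ ε > 0, ∃ n' ∈ P,
        ‖∫ t, f (n t) (t, ω) ∂μ - ∫ t, f (n' t) (t, ω) ∂μ‖ < ε := by
    intro N
    refine exists_countable_selectors (g := fun z (i : Fin (N + 1)) => f i z) μ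
      (measurable_pi_iff.2 fun i => hf i) fun ω => ?_
    exact Integrable.of_eval fun i => hseli (n := fun _ => (i : ℕ)) measurable_const ω
  choose P hPc hPm hPd using hfin
  have hval : ∀ {N : ℕ} {n : T → Fin (N + 1)}, Measurable n → Measurable fun t => (n t : ℕ) :=
    fun hn => (measurable_of_countable _).comp hn
  have hset : {ω | (aumannIntegral μ (F ω) ∩ V).Nonempty} =
      ⋃ N, ⋃ n ∈ P N, {ω | ∫ t, f (n t) (t, ω) ∂μ ∈ V} := by
    ext ω
    simp only [Set.mem_ofPred_eq, Set.mem_iUnion]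
    constructor
    · rintro ⟨_, ⟨h, ⟨hint, hF⟩, rfl⟩, hhV⟩
      obtain ⟨ε, hε, hball⟩ := Metric.isOpen_iff.1 hV _ hhV
      obtain ⟨h', hh', hae⟩ := hint.1
      have hh'm := hh'.measurable
      -- The `+ 1` keeps the denominator positive when `μ = 0`.
      let δ : ℝ := ε / (3 * (μ.real Set.univ + 1))
      have hμ : 0 ≤ μ.real Set.univ := measureReal_nonneg
      have hδ : 0 < δ := by positivity
      have hδμ : δ * μ.real Set.univ < ε / 3 := by
        have : δ * (μ.real Set.univ + 1) = ε / 3 := by simp only [δ]; field_simp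
        linarith
      -- The second alternative only makes `Nat.find` total; by density it fails wherever `h' t = h
      -- t ∈ F ω t`, hence almost everywhere.
      let q : T → ℕ → Prop := fun t k =>
        ‖h' t - f k (t, ω)‖ < δ ∨ ∀ j, δ ≤ ‖h' t - f j (t, ω)‖
      have hq : ∀ t, ∃ k, q t k := by
        intro t
        by_cases hk : ∃ k, ‖h' t - f k (t, ω)‖ < δ
        · exact hk.imp fun k hk => Or.inl hk
        · push Not at hk
          exact ⟨0, Or.inr hk⟩
      have hnm : ∀ k, Measurable fun t => ‖h' t - f k (t, ω)‖ := fun k =>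
        (hh'm.sub ((hf k).comp measurable_prodMk_right)).norm
      have hqm : ∀ k, MeasurableSet {t | q t k} := by
        intro k
        have : {t | q t k} = {t | ‖h' t - f k (t, ω)‖ < δ} ∪
            ⋂ j, {t | δ ≤ ‖h' t - f j (t, ω)‖} := by
          ext t
          simp [q]
        rw [this]
        exact (measurableSet_lt (hnm k) measurable_const).union
          (MeasurableSet.iInter fun j => measurableSet_le measurable_const (hnm j))
      classical
      let n : T → ℕ := fun t => Nat.find (hq t)
      have hn : Measurable n := measurable_find hq hqm
      have hclose : ‖∫ t, h t ∂μ - ∫ t, f (n t) (t, ω) ∂μ‖ < ε / 3 := by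
        rw [← integral_sub hint (hseli hn ω)]
        refine (norm_integral_le_of_norm_le_const ?_).trans_lt hδμ
        filter_upwards [hF, hae] with t ht hte
        rcases Nat.find_spec (hq t) with h1 | h1
        · rw [hte]; exact h1.le
        · obtain ⟨_, ⟨k, rfl⟩, hk⟩ := Metric.mem_closure_iff.1 (hdense t ω ht) δ hδ
          rw [dist_eq_norm, hte] at hk
          exact absurd hk (not_lt.2 (h1 k))
      -- Truncation makes the selector finite-valued; for fixed `t` it equals `n t` once `N ≥ n t`,
      -- so dominated convergence applies.
      let m : (N : ℕ) → T → Fin (N + 1) := fun N t => Fin.ofNat (N + 1) (min (n t) N)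
      have hmval : ∀ N t, (m N t : ℕ) = min (n t) N := fun N t =>
        Nat.mod_eq_of_lt (by omega)
      have hm : ∀ N, Measurable (m N) := fun N => (measurable_of_countable
        fun i : ℕ => Fin.ofNat (N + 1) (min i N)).comp hn
      have htend : Tendsto (fun N => ∫ t, f (m N t) (t, ω) ∂μ) atTop
          (𝓝 (∫ t, f (n t) (t, ω) ∂μ)) := by
        refine tendsto_integral_of_dominated_convergence (fun t => b t ω)
          (fun N => (hseli (hval (hm N)) ω).1) (hb ω)
          (fun N => ae_of_all _ fun t => hle _ _ _) (ae_of_all _ fun t => ?_)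
        refine tendsto_const_nhds.congr' ?_
        filter_upwards [eventually_ge_atTop (n t)] with N hN
        rw [hmval, min_eq_left hN]
      obtain ⟨N, hN⟩ := (Metric.tendsto_atTop.1 htend (ε / 3) (by positivity))
      have hN := hN N le_rfl
      obtain ⟨n', hn'P, hn'⟩ := hPd N ω (m N) (hm N) (ε / 3) (by positivity)
      refine ⟨N, n', hn'P, hball ?_⟩
      rw [← dist_eq_norm, dist_comm] at hn' hclose
      exact (dist_triangle4 _ _ _ _).trans_lt (by linarith)
    · rintro ⟨N, n, hn, hω⟩
      exact ⟨_, ⟨_, ⟨hseli (hval (hPm N n hn)) ω, ae_of_all _ fun t => hmem _ _ _⟩, rfl⟩, hω⟩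
  rw [hset]
  refine MeasurableSet.iUnion fun N => MeasurableSet.biUnion (hPc N) fun n hn => ?_
  exact (hsel (hval (hPm N n hn))).stronglyMeasurable.integral_prod_left'.measurable
    hV.measurableSet

/-! ### Prices -/

section Prices

variable {ℓ : ℕ} {p : Fin ℓ → ℝ}

theorem minPrice_le (h : Fin ℓ) : minPrice p ≤ p h := ciInf_le (Set.finite_range p).bddBelow h

theorem minPrice_pos (hp : p ∈ priceSimplex ℓ) : 0 < minPrice p := by
  have : Nonempty (Fin ℓ) := by
    by_contra hne
    rw [not_nonempty_iff] at hne
    simpa using hp.2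
  obtain ⟨h, hh⟩ := exists_eq_ciInf_of_finite (f := p)
  rw [minPrice, ← hh]
  exact hp.1 h

theorem price_le_one (hp : p ∈ priceSimplex ℓ) (h : Fin ℓ) : p h ≤ 1 :=
  hp.2 ▸ Finset.single_le_sum (fun i _ => (hp.1 i).le) (Finset.mem_univ h)

/-- The budget set of an agent with unit income. -/
def unitBudget (p : Fin ℓ → ℝ) : Set (Fin ℓ → ℝ) := {q | 0 ≤ q ∧ ∑ h, p h * q h ≤ 1}

end Prices

/-! ### Budget sets, the preferred set and its dense measurable selections -/

section Agents

variable {T Ω : Type*} {ℓ : ℕ} {a : T → Ω → Fin ℓ → ℝ} {U : T → Ω → (Fin ℓ → ℝ) → ℝ}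
  {p : Fin ℓ → ℝ} {t : T} {ω : Ω} {x : Fin ℓ → ℝ}

theorem smul_mem_orthant {c : ℝ} (hc : 0 ≤ c) (hx : 0 ≤ x) : c • x ∈ orthant ℓ :=
  smul_nonneg hc hx

theorem income_nonneg (ha : a t ω ∈ orthant ℓ) (hp : p ∈ priceSimplex ℓ) :
    0 ≤ ∑ h, p h * a t ω h :=
  Finset.sum_nonneg fun h _ => mul_nonneg (hp.1 h).le (ha h)

theorem boundLevel_nonneg (ha : a t ω ∈ orthant ℓ) (hp : p ∈ priceSimplex ℓ) :
    0 ≤ boundLevel a t ω p :=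
  mul_nonneg (one_div_nonneg.2 (minPrice_pos hp).le) (Finset.sum_nonneg fun h _ => ha h)

/-- Reduces the varying budget sets to one fixed set, so that a single dense sequence serves all
`(t, ω)`. At zero income, positive prices force the budget set to be `{0}`. -/
theorem budget_eq_smul_unitBudget (ha : a t ω ∈ orthant ℓ) (hp : p ∈ priceSimplex ℓ) :
    budget a t ω p = (fun q => (∑ h, p h * a t ω h) • q) '' unitBudget p := by
  have hw := income_nonneg ha hp
  ext x
  constructor
  · rintro ⟨hx, hxp⟩
    rcases hw.eq_or_lt with hw0 | hw0
    · refine ⟨0, ⟨le_rfl, by simp⟩, ?_⟩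
      have hx0 : ∑ h, p h * x h = 0 :=
        le_antisymm (hxp.trans hw0.ge) (Finset.sum_nonneg fun h _ => mul_nonneg (hp.1 h).le (hx h))
      rw [Finset.sum_eq_zero_iff_of_nonneg fun h _ => mul_nonneg (hp.1 h).le (hx h)] at hx0
      ext h
      have := hx0 h (Finset.mem_univ h)
      rw [mul_eq_zero, or_iff_right (hp.1 h).ne'] at this
      simp [this]
    · refine ⟨(∑ h, p h * a t ω h)⁻¹ • x, ⟨smul_nonneg (inv_nonneg.2 hw) hx, ?_⟩,
        smul_inv_smul₀ hw0.ne' x⟩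
      simp only [Pi.smul_apply, smul_eq_mul, mul_left_comm (p _)]
      rw [← Finset.mul_sum, inv_mul_le_one₀ hw0]
      exact hxp
  · rintro ⟨q, ⟨hq, hqp⟩, rfl⟩
    refine ⟨smul_mem_orthant hw hq, ?_⟩
    simp only [Pi.smul_apply, smul_eq_mul, mul_left_comm (p _)]
    rw [← Finset.mul_sum]
    exact mul_le_of_le_one_right hw hqp

theorem le_boundVector_of_mem_budget (ha : a t ω ∈ orthant ℓ) (hp : p ∈ priceSimplex ℓ)
    (hx : x ∈ budget a t ω p) : x ≤ boundVector a t ω p := by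
  intro h
  change x h ≤ 1 / minPrice p * ∑ h, a t ω h
  rw [one_div, ← div_eq_inv_mul, le_div_iff₀ (minPrice_pos hp)]
  calc x h * minPrice p ≤ x h * p h := mul_le_mul_of_nonneg_left (minPrice_le h) (hx.1 h)
    _ = p h * x h := mul_comm _ _
    _ ≤ ∑ i, p i * x i :=
        Finset.single_le_sum (f := fun i => p i * x i)
          (fun i _ => mul_nonneg (hp.1 i).le (hx.1 i)) (Finset.mem_univ h)
    _ ≤ ∑ i, p i * a t ω i := hx.2
    _ ≤ ∑ i, a t ω i :=
        Finset.sum_le_sum fun i _ => mul_le_of_le_one_left (ha i) (price_le_one hp i)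

theorem UtilityMonotone.lt_of_le_of_ne (hU : UtilityMonotone U) {y : Fin ℓ → ℝ}
    (hx : x ∈ orthant ℓ) (hxy : x ≤ y) (hne : x ≠ y) : U t ω x < U t ω y := by
  have := hU t ω x hx (y - x) (sub_nonneg.2 hxy) (sub_ne_zero.2 hne.symm)
  rwa [add_sub_cancel] at this

theorem boundVector_mem_orthant (ha : a t ω ∈ orthant ℓ) (hp : p ∈ priceSimplex ℓ) :
    boundVector a t ω p ∈ orthant ℓ := fun _ => boundLevel_nonneg ha hp

/-- The bound dominates the whole budget set, so monotonicity makes it a selection that is always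
available as a fallback. -/
theorem boundVector_mem_preferredX (hU : UtilityMonotone U) (ha : a t ω ∈ orthant ℓ)
    (hp : p ∈ priceSimplex ℓ) : boundVector a t ω p ∈ preferredX a U t ω p := by
  have hb := boundVector_mem_orthant ha hp
  refine ⟨⟨hb, fun x hx => ?_⟩, hb, le_rfl⟩
  rcases eq_or_ne x (boundVector a t ω p) with rfl | hne
  · exact le_rfl
  · exact (hU.lt_of_le_of_ne hx.1 (le_boundVector_of_mem_budget ha hp hx) hne).le

theorem smul_mem_boundedSet (ha : a t ω ∈ orthant ℓ) (hp : p ∈ priceSimplex ℓ)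
    {c : Fin ℓ → ℝ} (hc : c ∈ Set.Icc (0 : Fin ℓ → ℝ) 1) :
    boundLevel a t ω p • c ∈ boundedSet a t ω p := by
  have hγ := boundLevel_nonneg ha hp
  exact ⟨smul_mem_orthant hγ hc.1, fun h => mul_le_of_le_one_right hγ (hc.2 h)⟩

theorem norm_le_of_mem_boundedSet (ha : a t ω ∈ orthant ℓ) (hp : p ∈ priceSimplex ℓ)
    (hx : x ∈ boundedSet a t ω p) : ‖x‖ ≤ boundLevel a t ω p := by
  refine (pi_norm_le_iff_of_nonneg (boundLevel_nonneg ha hp)).2 fun h => ?_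
  rw [Real.norm_of_nonneg (hx.1 h)]
  exact hx.2 h

theorem continuous_utility_smul (hU : ContinuousOn (U t ω) (orthant ℓ)) {c : ℝ} (hc : 0 ≤ c)
    {S : Set (Fin ℓ → ℝ)} (hS : S ⊆ orthant ℓ) : Continuous fun q : S => U t ω (c • q.1) :=
  hU.comp_continuous (continuous_subtype_val.const_smul c) fun q =>
    smul_mem_orthant hc (hS q.2)

/-- Preferred bundles that are multiples of points of a dense sequence of the unit cube, together
with the upper bound, are dense in the preferred set. -/
theorem preferredX_subset_closure (hU : ContinuousOn (U t ω) (orthant ℓ))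
    (hUm : UtilityMonotone U) (ha : a t ω ∈ orthant ℓ) (hp : p ∈ priceSimplex ℓ)
    {c : ℕ → Set.Icc (0 : Fin ℓ → ℝ) 1} (hc : DenseRange c) {S : Set (Fin ℓ → ℝ)}
    (hbS : boundVector a t ω p ∈ S)
    (hcS : ∀ k, boundLevel a t ω p • (c k).1 ∈ preferred a U t ω p →
      boundLevel a t ω p • (c k).1 ∈ S) :
    preferredX a U t ω p ⊆ closure S := by
  rintro x ⟨hxC, hx0, hxb⟩
  rcases eq_or_ne x (boundVector a t ω p) with rfl | hne
  · exact subset_closure hbS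
  set b := boundVector a t ω p with hb
  set γ := boundLevel a t ω p with hγ
  -- If `γ = 0`, the bounded set is `{0}` and `x` would equal `b`.
  have hγ0 : 0 < γ := by
    refine (boundLevel_nonneg ha hp).lt_of_ne fun h0 => hne (le_antisymm hxb ?_)
    intro h
    change boundLevel a t ω p ≤ x h
    rw [← h0]
    exact hx0 h
  rw [Metric.mem_closure_iff]
  intro ε hε
  have hpath : Tendsto (fun s : ℝ => x + s • (b - x)) (𝓝[>] 0) (𝓝 x) := by
    have : Continuous fun s : ℝ => x + s • (b - x) := by fun_prop
    simpa using (this.tendsto 0).mono_left nhdsWithin_le_nhds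
  obtain ⟨s, hsε, hs⟩ := ((hpath.eventually (Metric.ball_mem_nhds x hε)).and
    (Ioo_mem_nhdsGT (zero_lt_one (α := ℝ)))).exists
  -- Strictly better than `x`, still below `b`, and within `ε` of `x`.
  set y := x + s • (b - x) with hy
  have hxy : x ≤ y := le_add_of_nonneg_right (smul_nonneg hs.1.le (sub_nonneg.2 hxb))
  have hyb : y ≤ b := by
    have : s • (b - x) ≤ (1 : ℝ) • (b - x) :=
      smul_le_smul_of_nonneg_right hs.2.le (sub_nonneg.2 hxb)
    rw [one_smul] at this
    exact (add_le_add_right this x).trans_eq (add_sub_cancel x b)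
  have hxney : x ≠ y := by
    rw [hy, Ne, left_eq_add, smul_eq_zero, not_or]
    exact ⟨hs.1.ne', sub_ne_zero.2 hne.symm⟩
  have hUxy : U t ω x < U t ω y := hUm.lt_of_le_of_ne hx0 hxy hxney
  have hycube : γ⁻¹ • y ∈ Set.Icc (0 : Fin ℓ → ℝ) 1 := by
    refine ⟨smul_nonneg (inv_nonneg.2 hγ0.le) (hx0.trans hxy), fun h => ?_⟩
    simp only [Pi.smul_apply, smul_eq_mul, Pi.one_apply]
    rw [inv_mul_le_one₀ hγ0]
    exact hyb h
  -- Anything strictly better than the preferred `x` is preferred, so a dense-sequence point in this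
  -- open set is retained.
  have hopen : IsOpen {q : Set.Icc (0 : Fin ℓ → ℝ) 1 |
      U t ω x < U t ω (γ • q.1) ∧ dist x (γ • q.1) < ε} :=
    (isOpen_lt continuous_const (continuous_utility_smul hU hγ0.le fun q hq => hq.1)).inter
      (isOpen_lt (continuous_const.dist (continuous_subtype_val.const_smul γ)) continuous_const)
  obtain ⟨k, hk1, hk2⟩ := hc.exists_mem_open hopen ⟨⟨γ⁻¹ • y, hycube⟩, by
    simp only [Set.mem_ofPred_eq, smul_inv_smul₀ hγ0.ne']
    exact ⟨hUxy, by rw [dist_comm]; exact hsε⟩⟩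
  exact ⟨_, hcS k ⟨smul_mem_orthant hγ0.le (c k).2.1, fun z hz => (hxC.2 z hz).trans hk1.le⟩, hk2⟩

variable [MeasurableSpace T] [MeasurableSpace Ω]

/-- Carathéodory argument: continuous in the bundle and measurable in `(t, ω)` implies jointly
measurable on the orthant. -/
theorem UtilityRegular.measurable_eval (hU : UtilityRegular U) {y : T × Ω → Fin ℓ → ℝ}
    (hy : Measurable y) (hmem : ∀ z, y z ∈ orthant ℓ) :
    Measurable fun z : T × Ω => U z.1 z.2 (y z) := by
  have : Measurable (Function.uncurry fun (x : orthant ℓ) (z : T × Ω) => U z.1 z.2 x.1) :=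
    measurable_uncurry_of_continuous_of_measurable
      (fun z => (continuousOn_iff_continuous_domRestrict.1 (hU.continuousOn z.1 z.2)))
      fun x => hU.measurable x.1 x.2
  exact this.comp ((hy.subtype_mk (h := hmem)).prodMk measurable_id)

/-- By continuity it is enough to compare with income times a dense sequence of `unitBudget p`,
which leaves countably many measurable conditions. -/
theorem measurableSet_mem_preferred (hU : UtilityRegular U)
    (ha : ∀ t ω, a t ω ∈ orthant ℓ) (ham : Measurable fun z : T × Ω => a z.1 z.2)
    (hp : p ∈ priceSimplex ℓ) {y : T × Ω → Fin ℓ → ℝ} (hy : Measurable y)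
    (hmem : ∀ z, y z ∈ orthant ℓ) :
    MeasurableSet {z : T × Ω | y z ∈ preferred a U z.1 z.2 p} := by
  have hne : Nonempty (unitBudget p) := ⟨⟨0, le_rfl, by simp⟩⟩
  let q : ℕ → unitBudget p := TopologicalSpace.denseSeq _
  have hset : {z : T × Ω | y z ∈ preferred a U z.1 z.2 p} =
      ⋂ j, {z | U z.1 z.2 ((∑ h, p h * a z.1 z.2 h) • (q j).1) ≤ U z.1 z.2 (y z)} := by
    ext ⟨t, ω⟩
    simp only [preferred, Set.mem_ofPred_eq, Set.mem_iInter, hmem, true_and,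
      budget_eq_smul_unitBudget (ha t ω) hp, Set.forall_mem_image]
    refine ⟨fun h j => h (q j).2, fun h x hx => ?_⟩
    exact (TopologicalSpace.denseRange_denseSeq (unitBudget p)).induction_on
      (p := fun x => U t ω ((∑ h, p h * a t ω h) • x.1) ≤ U t ω (y (t, ω))) ⟨x, hx⟩
      (isClosed_le (continuous_utility_smul (hU.continuousOn t ω) (income_nonneg (ha t ω) hp)
        fun q hq => hq.1) continuous_const) h
  rw [hset]
  refine MeasurableSet.iInter fun j => measurableSet_le (hU.measurable_eval ?_ fun z => ?_)
    (hU.measurable_eval hy hmem)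
  · exact (Finset.measurable_sum _ fun h _ =>
      ((measurable_pi_apply h).comp ham).const_mul (p h)).smul_const _
  · exact smul_mem_orthant (income_nonneg (ha _ _) hp) (q j).2.1

end Agents

end DiffInfoEconomy

theorem mainTheorem3 {T Ω : Type*} [MeasurableSpace T] [MeasurableSpace Ω] {ℓ : ℕ}
    (μ : Measure T) [IsFiniteMeasure μ]
    (ν : Measure Ω) [IsProbabilityMeasure ν] [ν.IsComplete]
    (a : T → Ω → Fin ℓ → ℝ) (U : T → Ω → (Fin ℓ → ℝ) → ℝ)
    (hA₁ : DiffInfoEconomy.EndowmentAssumption μ a)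
    (hA₂ : DiffInfoEconomy.UtilityRegular U)
    (hA₃ : DiffInfoEconomy.UtilityMonotone U)
    (p : Fin ℓ → ℝ) (hp : p ∈ DiffInfoEconomy.priceSimplex ℓ) :
    DiffInfoEconomy.LowerMeasurable (fun ω =>
      DiffInfoEconomy.aumannIntegral μ (fun t => DiffInfoEconomy.preferredX a U t ω p)) := by
  open DiffInfoEconomy in
  classical
  have ha := hA₁.mem_orthant
  have hne : Nonempty (Set.Icc (0 : Fin ℓ → ℝ) 1) := ⟨⟨0, le_rfl, zero_le_one⟩⟩
  let c : ℕ → Set.Icc (0 : Fin ℓ → ℝ) 1 := TopologicalSpace.denseSeq _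
  have hc : DenseRange c := TopologicalSpace.denseRange_denseSeq _
  have hγm : Measurable fun z : T × Ω => boundLevel a z.1 z.2 p :=
    (Finset.measurable_sum _ fun h _ =>
      (measurable_pi_apply h).comp hA₁.measurable).const_mul (1 / minPrice p)
  have hbm : Measurable fun z : T × Ω => boundVector a z.1 z.2 p :=
    measurable_pi_iff.2 fun _ => hγm
  -- The index `none` guarantees that the bound itself is among the selections, even if every cube
  -- point is retained.
  let f : Option ℕ → T × Ω → Fin ℓ → ℝ := fun o z => o.elim (boundVector a z.1 z.2 p) fun k =>
    if boundLevel a z.1 z.2 p • (c k).1 ∈ preferred a U z.1 z.2 p then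
      boundLevel a z.1 z.2 p • (c k).1 else boundVector a z.1 z.2 p
  have hfm : ∀ o, Measurable (f o) := by
    rintro (_ | k)
    · exact hbm
    · have hcm : Measurable fun z : T × Ω => boundLevel a z.1 z.2 p • (c k).1 :=
        hγm.smul_const _
      exact Measurable.ite (measurableSet_mem_preferred hA₂ ha hA₁.measurable hp hcm
        fun z => smul_mem_orthant (boundLevel_nonneg (ha _ _) hp) (c k).2.1) hcm hbm
  have hmem : ∀ o t ω, f o (t, ω) ∈ preferredX a U t ω p := by
    rintro (_ | k) t ω
    · exact boundVector_mem_preferredX hA₃ (ha t ω) hp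
    · by_cases hk : boundLevel a t ω p • (c k).1 ∈ preferred a U t ω p
      · simp only [f, Option.elim, if_pos hk]
        exact ⟨hk, smul_mem_boundedSet (ha t ω) hp (c k).2⟩
      · simp only [f, Option.elim, if_neg hk]
        exact boundVector_mem_preferredX hA₃ (ha t ω) hp
  obtain ⟨e⟩ : Nonempty (ℕ ≃ Option ℕ) := nonempty_equiv_of_countable
  refine lowerMeasurable_aumannIntegral_of_castaing μ (f := fun n => f (e n))
    (b := fun t ω => boundLevel a t ω p) (fun n => hfm _) (fun n => hmem _) (fun t ω => ?_)
    (fun ω => ?_) fun n t ω => norm_le_of_mem_boundedSet (ha t ω) hp (hmem _ t ω).2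
  · refine preferredX_subset_closure (hA₂.continuousOn t ω) hA₃ (ha t ω) hp hc
      ⟨e.symm none, by simp [f]⟩ fun k hk => ⟨e.symm (some k), by simp [f, hk]⟩
  · exact (integrable_finsetSum _ fun h _ => (hA₁.integrable ω).eval h).const_mul _
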